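/- Labelings and sketches. A family $\mathcal F$ of finite simple graphs is given; $\mathcal F_n$ is the set of its members with $n$ vertices. An adjacency sketch of size $c(n)$ and error $\delta$ for $\mathcal F$ consists of a decoder $D:\{0,1\}^*\times\{0,1\}^*\to\{0,1\}$ and, for every $G\in\mathcal F_n$, a probability distribution $L_G$ on labelings $\ell:V(G)\to\{0,1\}^{c(n)}$ such that for all $u,v\in V(G)$ we have $D(\ell(u),\ell(v))=\mathbf 1_{uv\in E(G)}$ with probability at least $1-\delta$ over $\ell\sim L_G$. It only errs on non-edges if $D(\ell(u),\ell(v))=1$ for every edge $uv$ of every $G\in\mathcal F$ and every $\ell$ in the support of $L_G$. Resilience. An adversary chooses $G\in\mathcal F_n$, and $\ell\sim L_G$ is drawn. The (computationally unbounded, possibly randomized) adversary adaptively asks for the labels $\ell(x_1),\dots,\ell(x_m)$ of vertices of its choice, where each query and the decision to stop may depend on the previous answers, and then declares two distinct vertices $x,y$ that were not asked. It wins if $D(\ell(x),\ell(y))\ne\mathbf 1_{xy\in E(G)}$. A sketch that only errs on non-edges is adversarially resilient with probability of forgery $\varepsilon$ if every adversary wins with probability at most $\varepsilon$. The arboricity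 of a graph is the minimum number of forests into which its edges can be partitioned. Statement. For every $k\in\mathbb N$ and every $\varepsilon\in(0,1)$ there is a constant $C>0$ such that for every $d\in\mathbb N$ the family of finite graphs of arboricity at most $k$ and maximum degree at most $d$ has an adjacency sketch with error $\varepsilon$ which only errs on non-edges, is adversarially resilient with probability of forgery $\varepsilon$, and has size $c(n)\le C\cdot\min\{d,\sqrt{\log_2 n}\}$ for all $n\ge 1$. -/

import Mathlib

/-- The edges of `G` can be partitioned into `k` forests (some of them possibly without edges). -/
def SimpleGraph.HasForestPartition {V : Type*} (G : SimpleGraph V) (k : ℕ) : Prop :=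
  ∃ F : Fin k → SimpleGraph V,
    (∀ i, (F i).IsAcyclic) ∧ (∀ i j, i ≠ j → Disjoint (F i).edgeSet (F j).edgeSet) ∧
      (⋃ i, (F i).edgeSet) = G.edgeSet

/-- The arboricity of `G`: the minimum number of forests into which its edges can be
partitioned (`⊤` if there is no such number, which does not happen for finite graphs). -/
noncomputable def SimpleGraph.arboricity {V : Type*} (G : SimpleGraph V) : ℕ∞ :=
  ⨅ (k : ℕ) (_ : G.HasForestPartition k), (k : ℕ∞)

/-- A family of finite graphs, given by its members with `n` vertices for every `n`. The vertex
set of a graph with `n` vertices is taken to be `Fin n`. -/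
abbrev GraphFamily : Type := (n : ℕ) → Set (SimpleGraph (Fin n))

open Classical in
/-- The family of graphs of arboricity at most `k` and maximum degree at most `d`. -/
noncomputable def boundedArboricityDegree (k d : ℕ) : GraphFamily :=
  fun _ => {G | G.arboricity ≤ (k : ℕ∞) ∧ G.maxDegree ≤ d}

/-- Binary strings of length `m`. -/
abbrev BitString (m : ℕ) : Type := Fin m → Bool

/-- The probability of the event `E` under the distribution `p`. -/
noncomputable def PMF.pr {α : Type*} (p : PMF α) (E : Set α) : ℝ :=
  (p.toOuterMeasure E).toReal

/-- The data of an adjacency sketch: the label size `c(n)`, the deterministic decoder on pairs of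
binary strings, and the randomized encoder, which for a graph with `n` vertices is a distribution
of labelings of its vertices by strings of length `c(n)`. -/
structure AdjacencySketch where
  size : ℕ → ℕ
  decoder : List Bool → List Bool → Bool
  encoder : (n : ℕ) → SimpleGraph (Fin n) → PMF (Fin n → BitString (size n))

/-- A deterministic strategy of an adaptive adversary that receives labels in `L` of vertices in
`V`: it either declares its two candidates, or queries the label of a vertex and continues
depending on the answer. -/
inductive AdversaryStrategy (V L : Type) : Type
  | declare (x y : V) : AdversaryStrategy V L
  | query (x : V) (next : L → AdversaryStrategy V L) : AdversaryStrategy V L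

/-- The pair of candidates that the strategy declares when the labels are given by `l`. -/
def AdversaryStrategy.candidates {V L : Type} (l : V → L) : AdversaryStrategy V L → V × V
  | .declare x y => (x, y)
  | .query x next => (next (l x)).candidates l

/-- The set of vertices that the strategy queries when the labels are given by `l`. -/
def AdversaryStrategy.queried {V L : Type} (l : V → L) : AdversaryStrategy V L → Set V
  | .declare _ _ => ∅
  | .query x next => insert x ((next (l x)).queried l)

namespace AdjacencySketch

/-- Under the labeling `l` of `G` the decoder is correct on the pair `(u, v)`. -/
def DecodesCorrectly (S : AdjacencySketch) {n : ℕ} (G : SimpleGraph (Fin n))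
    (l : Fin n → BitString (S.size n)) (u v : Fin n) : Prop :=
  S.decoder (List.ofFn (l u)) (List.ofFn (l v)) = true ↔ G.Adj u v

/-- `S` is an adjacency sketch for the family `F` with error `δ`. -/
def IsSketchFor (S : AdjacencySketch) (F : GraphFamily) (δ : ℝ) : Prop :=
  ∀ n : ℕ, ∀ G ∈ F n, ∀ u v : Fin n,
    1 - δ ≤ (S.encoder n G).pr {l | S.DecodesCorrectly G l u v}

/-- On graphs of the family `F`, the sketch `S` only errs on non-edges: for every labeling that
the encoder may output, the decoder accepts every edge. -/
def OnlyErrsOnNonEdges (S : AdjacencySketch) (F : GraphFamily) : Prop :=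
  ∀ n : ℕ, ∀ G ∈ F n, ∀ l ∈ (S.encoder n G).support, ∀ u v : Fin n,
    G.Adj u v → S.decoder (List.ofFn (l u)) (List.ofFn (l v)) = true

/-- The adversary playing the strategy `A` wins against the labeling `l` of `G`: the two
candidates are distinct vertices that were not queried, and they are decoded wrongly.
(As two vertices are left over, at most `n - 2` different vertices were queried.) -/
def Wins (S : AdjacencySketch) {n : ℕ} (G : SimpleGraph (Fin n))
    (l : Fin n → BitString (S.size n))
    (A : AdversaryStrategy (Fin n) (BitString (S.size n))) : Prop :=
  (A.candidates l).1 ≠ (A.candidates l).2 ∧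
    (A.candidates l).1 ∉ A.queried l ∧ (A.candidates l).2 ∉ A.queried l ∧
    ¬ S.DecodesCorrectly G l (A.candidates l).1 (A.candidates l).2

/-- The probability that a randomized adversary (a distribution of strategies, drawn independently
of the labels) wins the game on the graph `G`. -/
noncomputable def forgeryProbability (S : AdjacencySketch) {n : ℕ} (G : SimpleGraph (Fin n))
    (A : PMF (AdversaryStrategy (Fin n) (BitString (S.size n)))) : ℝ :=
  (A.bind fun a => (S.encoder n G).map fun l => (a, l)).pr {q | S.Wins G q.2 q.1}

/-- `S` is adversarially resilient on the family `F` with probability of forgery `ε`: it only errs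
on non-edges, and whatever graph of the family and whatever randomized adaptive strategy the
adversary chooses, it wins with probability at most `ε`. -/
def IsResilient (S : AdjacencySketch) (F : GraphFamily) (ε : ℝ) : Prop :=
  S.OnlyErrsOnNonEdges F ∧
    ∀ n : ℕ, ∀ G ∈ F n, ∀ A : PMF (AdversaryStrategy (Fin n) (BitString (S.size n))),
      S.forgeryProbability G A ≤ ε

end AdjacencySketch

/-! Labels are vectors over a fixed prime field `F` with at least 4(k+1)/ε elements: every vertex
gets vectors a_1, …, a_{k+1} and r, and a pair is accepted if some a_i of one vertex is orthogonal
to r of the other. The labeling is uniform on a set Ω such that, for a non-edge xy and given all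
other vectors, a_i(x) and r(y) are independent and uniform in two subspaces that are not orthogonal
to each other (`FreeAt`). Such vectors are orthogonal with probability at most 2/|F|
(`card_mul_card_filter_orthogonal_le`).

This bound survives conditioning on any event that ignores the labels of x and y. That an adversary
declares x, y without having asked them is such an event, and these events are disjoint for
different pairs; summing over the non-edges gives resilience (`IsRobustLabeling.card_forged_le`).

Two choices of Ω yield the minimum. In dimension above (k+2)d one can demand orthogonality across
every edge: the neighbours impose too few linear conditions to force it on a non-edge
(`exists_isRobustLabeling_of_degree_le`). Alternatively, root the forests, so that every vertex has
at most one parent in each. Draw a_i(x) from a subspace attached to the i-th parent of x, and r(y)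
from the orthogonal space of the subspace attached to y. The graphs of t × t matrices are at least
2^(t²) subspaces of F^(2t), none contained in another, so t of order √(log n) suffices
(`exists_isRobustLabeling_of_parents`). -/

/-! ### Probabilities of events -/

open scoped Classical in
theorem PMF.pr_uniformOfFinset {α : Type*} (s : Finset α) (hs : s.Nonempty) (E : Set α) :
    (PMF.uniformOfFinset s hs).pr E = ((s.filter (· ∈ E)).card : ℝ) / s.card := by
  unfold PMF.pr
  rw [PMF.toOuterMeasure_uniformOfFinset_apply, ENNReal.toReal_div]
  simp

theorem PMF.pr_map {α β : Type*} (p : PMF α) (f : α → β) (E : Set β) :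
    (p.map f).pr E = p.pr (f ⁻¹' E) := by
  unfold PMF.pr
  rw [PMF.toOuterMeasure_map_apply]

theorem PMF.toOuterMeasure_ne_top {α : Type*} (p : PMF α) (E : Set α) :
    p.toOuterMeasure E ≠ ⊤ := by
  refine ne_top_of_le_ne_top ENNReal.one_ne_top ?_
  rw [PMF.toOuterMeasure_apply, ← p.tsum_coe]
  exact ENNReal.tsum_le_tsum fun a => Set.indicator_le_self _ _ a

theorem PMF.pr_bind_le {α β : Type*} (p : PMF α) (f : α → PMF β) (E : Set β) {ε : ℝ}
    (h : ∀ a, (f a).pr E ≤ ε) : (p.bind f).pr E ≤ ε := by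
  have hε : 0 ≤ ε := by
    obtain ⟨a, -⟩ := p.support_nonempty
    exact ENNReal.toReal_nonneg.trans (h a)
  unfold PMF.pr
  refine ENNReal.toReal_le_of_le_ofReal hε ?_
  rw [PMF.toOuterMeasure_bind_apply]
  calc ∑' a, p a * (f a).toOuterMeasure E ≤ ∑' a, p a * ENNReal.ofReal ε := by
        refine ENNReal.tsum_le_tsum fun a => ?_
        gcongr
        exact (ENNReal.le_ofReal_iff_toReal_le ((f a).toOuterMeasure_ne_top E) hε).2 (h a)
    _ = ENNReal.ofReal ε := by rw [ENNReal.tsum_mul_right, p.tsum_coe, one_mul]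

/-! ### Runs of adaptive strategies -/

namespace AdversaryStrategy

/-- A run of a strategy only depends on the labels of the queried vertices. -/
theorem run_congr {V L : Type} {l l' : V → L} (A : AdversaryStrategy V L)
    (h : ∀ v ∈ A.queried l, l v = l' v) :
    A.candidates l' = A.candidates l ∧ A.queried l' = A.queried l := by
  induction A with
  | declare x y => exact ⟨rfl, rfl⟩
  | query x next ih =>
    have hx : l x = l' x := h x (Set.mem_insert _ _)
    obtain ⟨h1, h2⟩ := ih (l x) fun v hv => h v (Set.mem_insert_of_mem _ hv)
    simp only [candidates, queried, ← hx, h1, h2, and_self]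

/-- The labelings against which the strategy declares `x` and `y`, without having asked them. -/
def declares {V L : Type} (A : AdversaryStrategy V L) (x y : V) : Set (V → L) :=
  {l | A.candidates l = (x, y) ∧ x ∉ A.queried l ∧ y ∉ A.queried l}

theorem declares_congr {V L : Type} (A : AdversaryStrategy V L) {x y : V} {l l' : V → L}
    (h : ∀ v, v ≠ x → v ≠ y → l v = l' v) (hl : l ∈ A.declares x y) : l' ∈ A.declares x y := by
  obtain ⟨h1, h2, h3⟩ := hl
  obtain ⟨h4, h5⟩ := A.run_congr (l := l) (l' := l') fun v hv =>
    h v (fun e => h2 (e ▸ hv)) (fun e => h3 (e ▸ hv))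
  refine ⟨h4.trans h1, ?_, ?_⟩ <;> rwa [h5]

end AdversaryStrategy

/-! ### Robust labelings and resilient sketches -/

open scoped Classical in
/-- The uniform distribution on `Ω` is a sound labeling of `G` for the acceptance relation `acc`:
edges are always accepted, and a non-edge `x y` is accepted with probability at most `ε`,
conditionally on every event that does not depend on the labels of `x` and `y`. -/
structure IsRobustLabeling {n : ℕ} {Λ : Type} (acc : Λ → Λ → Prop) (ε : ℝ)
    (G : SimpleGraph (Fin n)) (Ω : Finset (Fin n → Λ)) : Prop where
  nonempty : Ω.Nonempty
  accepts : ∀ l ∈ Ω, ∀ u v, G.Adj u v → acc (l u) (l v)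
  robust : ∀ x y, ¬ G.Adj x y → ∀ E : Set (Fin n → Λ),
    (∀ l l', (∀ v, v ≠ x → v ≠ y → l v = l' v) → l ∈ E → l' ∈ E) →
    ((Ω.filter fun l => l ∈ E ∧ acc (l x) (l y)).card : ℝ) ≤ ε * (Ω.filter (· ∈ E)).card

open scoped Classical in
/-- Against a robust labeling, every adaptive strategy forges with probability at most `ε`. -/
theorem IsRobustLabeling.card_forged_le {n : ℕ} {Λ L : Type} {acc : Λ → Λ → Prop} {ε : ℝ}
    (hε : 0 ≤ ε) {G : SimpleGraph (Fin n)} {Ω : Finset (Fin n → Λ)}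
    (h : IsRobustLabeling acc ε G Ω) (e : Λ → L) (A : AdversaryStrategy (Fin n) L) :
    ((Ω.filter fun l => ∃ x y, ¬ G.Adj x y ∧ (fun v => e (l v)) ∈ A.declares x y ∧
      acc (l x) (l y)).card : ℝ) ≤ ε * Ω.card := by
  let E : Fin n × Fin n → Set (Fin n → Λ) := fun q => {l | (fun v => e (l v)) ∈ A.declares q.1 q.2}
  let N : Finset (Fin n × Fin n) := Finset.univ.filter fun q => ¬ G.Adj q.1 q.2
  have h1 : (Ω.filter fun l => ∃ x y, ¬ G.Adj x y ∧ (fun v => e (l v)) ∈ A.declares x y ∧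
      acc (l x) (l y)) ⊆ N.biUnion fun q => Ω.filter fun l => l ∈ E q ∧ acc (l q.1) (l q.2) := by
    intro l hl
    obtain ⟨hl, x, y, hxy, hd, ha⟩ := Finset.mem_filter.1 hl
    exact Finset.mem_biUnion.2 ⟨(x, y), by simp [N, hxy], Finset.mem_filter.2 ⟨hl, hd, ha⟩⟩
  have h2 : (N.biUnion fun q => Ω.filter (· ∈ E q)) ⊆ Ω := by
    intro l hl
    obtain ⟨q, -, hl⟩ := Finset.mem_biUnion.1 hl
    exact (Finset.mem_filter.1 hl).1
  -- Against a given labeling the strategy declares only one pair.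
  have h3 : (N : Set (Fin n × Fin n)).PairwiseDisjoint fun q => Ω.filter (· ∈ E q) := by
    intro q _ q' _ hne
    refine Finset.disjoint_left.2 fun l hl hl' => hne ?_
    have a1 := (Finset.mem_filter.1 hl).2.1
    have a2 := (Finset.mem_filter.1 hl').2.1
    exact a1.symm.trans a2
  calc _ ≤ ((N.biUnion fun q => Ω.filter fun l => l ∈ E q ∧ acc (l q.1) (l q.2)).card : ℝ) := by
        exact_mod_cast Finset.card_le_card h1
    _ ≤ ∑ q ∈ N, ((Ω.filter fun l => l ∈ E q ∧ acc (l q.1) (l q.2)).card : ℝ) := by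
        exact_mod_cast Finset.card_biUnion_le
    _ ≤ ∑ q ∈ N, ε * ((Ω.filter (· ∈ E q)).card : ℝ) := by
        refine Finset.sum_le_sum fun q hq => h.robust q.1 q.2 (Finset.mem_filter.1 hq).2 (E q) ?_
        intro l l' hll hl
        exact A.declares_congr (fun v hx hy => congrArg e (hll v hx hy)) hl
    _ = ε * ((N.biUnion fun q => Ω.filter (· ∈ E q)).card : ℝ) := by
        rw [Finset.card_biUnion fun q hq q' hq' => h3 hq hq', ← Finset.mul_sum]
        push_cast; rfl
    _ ≤ ε * Ω.card := by
        gcongr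

open scoped Classical in
/-- Robust labelings by finite types `Λ m`, which can be told apart by the length of their binary
encodings, give a resilient adjacency sketch. -/
theorem exists_sketch_of_robustLabeling {Λ : ℕ → Type} [∀ m, Fintype (Λ m)] {c : ℕ → ℕ}
    (hc : Function.Injective c) (hcard : ∀ m, Fintype.card (Λ m) ≤ 2 ^ c m)
    (acc : ∀ m, Λ m → Λ m → Prop) (F : GraphFamily) {ε : ℝ} (hε : 0 ≤ ε) (μ : ℕ → ℕ)
    (H : ∀ n, ∀ G ∈ F n, ∃ Ω, IsRobustLabeling (acc (μ n)) ε G Ω) :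
    ∃ S : AdjacencySketch, S.IsSketchFor F ε ∧ S.IsResilient F ε ∧ ∀ n, S.size n = c (μ n) := by
  have henc : ∀ m, Nonempty (Λ m ↪ BitString (c m)) := fun m =>
    Function.Embedding.nonempty_of_card_le (by simpa using hcard m)
  let enc : ∀ m, Λ m ↪ BitString (c m) := fun m => (henc m).some
  choose Ω hΩ using H
  let S : AdjacencySketch :=
    { size := fun n => c (μ n)
      decoder := fun s t => decide (∃ m a b,
        s = List.ofFn (enc m a) ∧ t = List.ofFn (enc m b) ∧ acc m a b)
      encoder := fun n G => if h : G ∈ F n then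
          (PMF.uniformOfFinset (Ω n G h) (hΩ n G h).nonempty).map fun l v => enc (μ n) (l v)
        else PMF.pure fun _ _ => false }
  have hdec : ∀ m (a b : Λ m),
      S.decoder (List.ofFn (enc m a)) (List.ofFn (enc m b)) = true ↔ acc m a b := by
    intro m a b
    simp only [S, decide_eq_true_eq]
    constructor
    · rintro ⟨m', a', b', h1, h2, h3⟩
      -- The decoder does not know n; it recovers m from the length of the strings.
      have hm : m = m' := hc (by simpa using congrArg List.length h1)
      subst hm
      rwa [(enc m).injective (List.ofFn_injective h1), (enc m).injective (List.ofFn_injective h2)]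
    · exact fun h => ⟨m, a, b, rfl, rfl, h⟩
  have henc : ∀ n G (h : G ∈ F n), S.encoder n G =
      (PMF.uniformOfFinset (Ω n G h) (hΩ n G h).nonempty).map fun l v => enc (μ n) (l v) :=
    fun n G h => dif_pos h
  have hcor : ∀ n (G : SimpleGraph (Fin n)) (l : Fin n → Λ (μ n)) u v,
      S.DecodesCorrectly G (fun v => enc (μ n) (l v)) u v ↔
        (acc (μ n) (l u) (l v) ↔ G.Adj u v) := fun n G l u v =>
    iff_congr (hdec _ _ _) Iff.rfl
  refine ⟨S, ?_, ⟨?_, ?_⟩, fun n => rfl⟩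
  · intro n G hG u v
    have hR := hΩ n G hG
    have hpos : (0 : ℝ) < (Ω n G hG).card := by exact_mod_cast hR.nonempty.card_pos
    rw [henc n G hG, PMF.pr_map, PMF.pr_uniformOfFinset, le_div_iff₀ hpos]
    by_cases huv : G.Adj u v
    · rw [Finset.filter_true_of_mem]
      · nlinarith
      · intro l hl
        exact (hcor n G l u v).2 ⟨fun _ => huv, fun _ => hR.accepts l hl u v huv⟩
    · have h1 := hR.robust u v huv Set.univ (fun _ _ _ _ => trivial)
      have h2 := Finset.card_filter_add_card_filter_not (s := Ω n G hG)
        (fun l => acc (μ n) (l u) (l v))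
      have h3 : (Ω n G hG).filter (fun l => ¬ acc (μ n) (l u) (l v)) =
          (Ω n G hG).filter (· ∈ (fun (l : Fin n → Λ (μ n)) v => enc (μ n) (l v)) ⁻¹'
            {l | S.DecodesCorrectly G l u v}) := by
        refine Finset.filter_congr fun l _ => ?_
        refine Iff.trans ?_ (hcor n G l u v).symm
        simp [huv]
      rw [← h3]
      simp only [Set.mem_univ, true_and, Finset.filter_true] at h1
      have h2' : ((((Ω n G hG).filter (fun l => acc (μ n) (l u) (l v))).card : ℝ) +
        ((Ω n G hG).filter (fun l => ¬ acc (μ n) (l u) (l v))).card) = (Ω n G hG).card := by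
        exact_mod_cast h2
      linarith
  · intro n G hG l hl u v huv
    rw [henc n G hG, PMF.support_map] at hl
    obtain ⟨l, hl, rfl⟩ := hl
    exact (hdec _ _ _).2 ((hΩ n G hG).accepts l (by simpa using hl) u v huv)
  · intro n G hG A
    have hR := hΩ n G hG
    have hpos : (0 : ℝ) < (Ω n G hG).card := by exact_mod_cast hR.nonempty.card_pos
    refine PMF.pr_bind_le _ _ _ fun a => ?_
    rw [henc n G hG, PMF.pr_map, PMF.pr_map, PMF.pr_uniformOfFinset, div_le_iff₀ hpos]
    refine le_trans ?_ (hR.card_forged_le hε (enc (μ n)) a)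
    norm_cast
    refine Finset.card_le_card fun l hl => ?_
    obtain ⟨hl, hw⟩ := Finset.mem_filter.1 hl
    obtain ⟨-, h1, h2, h3⟩ := hw
    rw [hcor n G l] at h3
    refine Finset.mem_filter.2 ⟨hl, _, _, ?_, ⟨rfl, h1, h2⟩, ?_⟩
    · intro hadj
      exact h3 ⟨fun _ => hadj, fun _ => hR.accepts l hl _ _ hadj⟩
    · by_contra hacc
      exact h3 ⟨fun h => absurd h hacc, fun h => hR.accepts l hl _ _ h⟩

/-! ### Counting orthogonal pairs in two subspaces -/

section Counting

variable {F : Type} [Field F] [Fintype F] {ι : Type} [Fintype ι]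

open scoped Classical in
/-- A linear functional that does not vanish on `B` has at most `|B| / |F|` zeros in `B`. -/
theorem card_mul_card_filter_dotProduct_eq_zero_le [DecidableEq ι] (B : Submodule F (ι → F))
    {v b₀ : ι → F} (hb₀ : b₀ ∈ B) (h : v ⬝ᵥ b₀ ≠ 0) :
    Fintype.card F * (Finset.univ.filter fun b => b ∈ B ∧ v ⬝ᵥ b = 0).card ≤
      (Finset.univ.filter fun b => b ∈ B).card := by
  rw [← Finset.card_univ, ← Finset.card_product]
  -- The translates of the zero set by the multiples of `b₀` are disjoint: the functional takes the
  -- value c(v · b₀) on the translate by c b₀.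
  refine Finset.card_le_card_of_injOn (fun q => q.1 • b₀ + q.2) ?_ ?_
  · rintro ⟨c, b⟩ hq
    simp only [Finset.coe_product, Finset.coe_univ, Set.mem_prod, Finset.coe_filter,
      Finset.mem_univ, true_and, Set.mem_univ, Set.mem_ofPred_eq] at hq ⊢
    exact B.add_mem (B.smul_mem _ hb₀) hq.1
  · rintro ⟨c, b⟩ hq ⟨c', b'⟩ hq' heq
    simp only [Finset.coe_product, Finset.coe_univ, Set.mem_prod, Finset.coe_filter,
      Finset.mem_univ, true_and, Set.mem_univ, Set.mem_ofPred_eq] at hq hq' heq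
    have h1 := congrArg (v ⬝ᵥ ·) heq
    simp only [dotProduct_add, dotProduct_smul, hq.2, hq'.2, add_zero, smul_eq_mul] at h1
    have hc : c = c' := mul_right_cancel₀ h h1
    subst hc
    rw [add_left_cancel heq]

open scoped Classical in
/-- Independent uniform elements of two subspaces that are not orthogonal to each other are
orthogonal with probability at most `2 / |F|`. -/
theorem card_mul_card_filter_orthogonal_le [DecidableEq ι] (A B : Submodule F (ι → F))
    {a₀ b₀ : ι → F} (ha₀ : a₀ ∈ A) (hb₀ : b₀ ∈ B) (h : a₀ ⬝ᵥ b₀ ≠ 0) :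
    Fintype.card F * (Finset.univ.filter fun q : (ι → F) × (ι → F) =>
        (q.1 ∈ A ∧ q.2 ∈ B) ∧ q.1 ⬝ᵥ q.2 = 0).card ≤
      2 * (Finset.univ.filter fun q : (ι → F) × (ι → F) => q.1 ∈ A ∧ q.2 ∈ B).card := by
  set SA : Finset (ι → F) := Finset.univ.filter fun a => a ∈ A with hSA
  set SB : Finset (ι → F) := Finset.univ.filter fun b => b ∈ B with hSB
  have h0 : (Finset.univ.filter fun q : (ι → F) × (ι → F) => q.1 ∈ A ∧ q.2 ∈ B) = SA ×ˢ SB := by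
    ext q; simp [SA, SB]
  have h1 : (Finset.univ.filter fun q : (ι → F) × (ι → F) =>
        (q.1 ∈ A ∧ q.2 ∈ B) ∧ q.1 ⬝ᵥ q.2 = 0).card =
      ∑ a ∈ SA, (Finset.univ.filter fun b => b ∈ B ∧ a ⬝ᵥ b = 0).card := by
    rw [← Finset.card_sigma]
    refine Finset.card_bij' (fun q _ => ⟨q.1, q.2⟩) (fun s _ => (s.1, s.2)) ?_ ?_ ?_ ?_
    · intro q hq; simpa [SA, and_assoc] using hq
    · intro q hq; simpa [SA, and_assoc] using hq
    · intro q _; rfl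
    · intro q _; rfl
  have h2 : Fintype.card F * (SA.filter fun a => a ⬝ᵥ b₀ = 0).card ≤ SA.card := by
    have := card_mul_card_filter_dotProduct_eq_zero_le A (v := b₀) ha₀ (by rwa [dotProduct_comm])
    simpa only [hSA, Finset.filter_filter, dotProduct_comm b₀] using this
  rw [h0, h1, Finset.card_product, Finset.mul_sum]
  -- If a is orthogonal to `b₀`, all of `B` is conceded, but such a are at most a 1/|F| fraction of
  -- `A`; for every other a, at most a 1/|F| fraction of `B` is orthogonal to it.
  calc ∑ a ∈ SA, Fintype.card F * (Finset.univ.filter fun b => b ∈ B ∧ a ⬝ᵥ b = 0).card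
      ≤ ∑ a ∈ SA, ((if a ⬝ᵥ b₀ = 0 then Fintype.card F * SB.card else 0) + SB.card) := by
        refine Finset.sum_le_sum fun a _ => ?_
        split_ifs with hz
        · refine le_add_right (Nat.mul_le_mul_left _ (Finset.card_le_card ?_))
          intro b hb
          simp only [SB, Finset.mem_filter] at hb ⊢
          exact ⟨hb.1, hb.2.1⟩
        · rw [zero_add]
          exact card_mul_card_filter_dotProduct_eq_zero_le B hb₀ hz
    _ = (Fintype.card F * (SA.filter fun a => a ⬝ᵥ b₀ = 0).card) * SB.card
        + SA.card * SB.card := by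
        rw [Finset.sum_add_distrib, ← Finset.sum_filter, Finset.sum_const, Finset.sum_const,
          smul_eq_mul, smul_eq_mul]
        ring
    _ ≤ SA.card * SB.card + SA.card * SB.card := by gcongr
    _ = 2 * (SA.card * SB.card) := by ring

end Counting

/-! ### Vector labels and free pairs of vectors -/

section Vectors

/-- Labels consisting of vectors `a i` for `i : Fin k` (at `some i`) and a vector `r` (at `none`),
all of them of dimension `m` over `F`. -/
abbrev VectorLabel (F : Type) (k m : ℕ) : Type := Option (Fin k) → Fin m → F

/-- Two labels are accepted if a vector `a i` of one is orthogonal to the vector `r` of the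
other. -/
def VectorLabel.Accepts {F : Type} [Field F] {k m : ℕ} (s t : VectorLabel F k m) : Prop :=
  0 < m ∧ ∃ i, s (some i) ⬝ᵥ t none = 0 ∨ t (some i) ⬝ᵥ s none = 0

variable {F : Type} {V : Type} {k m : ℕ}

open scoped Classical in
/-- The labeling `l` with the vector `a i` of `x` and the vector `r` of `y` replaced. -/
noncomputable def replaceVectors (l : V → VectorLabel F k m) (x : V) (i : Fin k) (y : V)
    (a r : Fin m → F) : V → VectorLabel F k m :=
  fun v o => match o with
    | some j => if v = x ∧ j = i then a else l v (some j)
    | none => if v = y then r else l v none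

theorem replaceVectors_some (l : V → VectorLabel F k m) (x : V) (i : Fin k) (y : V)
    (a r : Fin m → F) : replaceVectors l x i y a r x (some i) = a := by
  simp [replaceVectors]

theorem replaceVectors_none (l : V → VectorLabel F k m) (x : V) (i : Fin k) (y : V)
    (a r : Fin m → F) : replaceVectors l x i y a r y none = r := by
  simp [replaceVectors]

theorem replaceVectors_of_ne (l : V → VectorLabel F k m) {x : V} (i : Fin k) {y : V}
    (a r : Fin m → F) {v : V} (hx : v ≠ x) (hy : v ≠ y) : replaceVectors l x i y a r v = l v := by
  funext o
  cases o <;> simp [replaceVectors, hx, hy]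

variable [Field F]

/-- In the set `Ω` of labelings the vectors `a i` of `x` and `r` of `y` are independent of each
other, and given all other vectors they range over two subspaces that are not orthogonal. -/
def FreeAt (Ω : Set (V → VectorLabel F k m)) (x : V) (i : Fin k) (y : V) : Prop :=
  ∀ l ∈ Ω, ∃ A B : Submodule F (Fin m → F), (∃ a ∈ A, ∃ b ∈ B, a ⬝ᵥ b ≠ 0) ∧
    ∀ a b, replaceVectors l x i y a b ∈ Ω ↔ a ∈ A ∧ b ∈ B

-- Zeroing the two vectors records all the others, so the fibres of this map consist of labelings
-- that differ only in these two vectors.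
open scoped Classical in
theorem replaceVectors_eq_iff {l l' : V → VectorLabel F k m} {x : V} {i : Fin k} {y : V} :
    replaceVectors l x i y 0 0 = replaceVectors l' x i y 0 0 ↔
      l' = replaceVectors l x i y (l' x (some i)) (l' y none) := by
  constructor
  · intro h
    funext v o
    have h1 := congrFun (congrFun h v) o
    cases o with
    | none =>
      simp only [replaceVectors] at h1 ⊢
      split_ifs at h1 ⊢ with hv
      · rw [hv]
      · exact h1.symm
    | some j =>
      simp only [replaceVectors] at h1 ⊢
      split_ifs at h1 ⊢ with hv
      · rw [hv.1, hv.2]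
      · exact h1.symm
  · intro h
    rw [h]
    funext v o
    cases o with
    | none => simp only [replaceVectors]; split_ifs <;> rfl
    | some j => simp only [replaceVectors]; split_ifs <;> rfl

variable [Fintype F] [Fintype V]

-- Sort the labelings by all vectors other than a i of `x` and r of `y`. As `E` ignores the labels
-- of `x` and `y`, each nonempty fibre in `Ω` ∩ `E` is a copy of A × B, to which the count for two
-- subspaces applies.
open scoped Classical in
theorem FreeAt.card_mul_card_filter_le {Ω : Finset (V → VectorLabel F k m)} {x y : V} {i : Fin k}
    (h : FreeAt (Ω : Set (V → VectorLabel F k m)) x i y) (E : Set (V → VectorLabel F k m))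
    (hE : ∀ l l', (∀ v, v ≠ x → v ≠ y → l v = l' v) → l ∈ E → l' ∈ E) :
    Fintype.card F * (Ω.filter fun l => l ∈ E ∧ l x (some i) ⬝ᵥ l y none = 0).card ≤
      2 * (Ω.filter (· ∈ E)).card := by
  set T := Ω.filter (· ∈ E) with hT
  let g : (V → VectorLabel F k m) → (V → VectorLabel F k m) := fun l => replaceVectors l x i y 0 0
  have e1 : (Ω.filter fun l => l ∈ E ∧ l x (some i) ⬝ᵥ l y none = 0) =
      T.filter fun l => l x (some i) ⬝ᵥ l y none = 0 := by rw [hT, Finset.filter_filter]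
  rw [e1, Finset.card_eq_sum_card_fiberwise (f := g) (s := T) (t := T.image g)
    (fun l hl => Finset.mem_image_of_mem g hl),
    Finset.card_eq_sum_card_fiberwise (f := g) (t := T.image g)
      (s := T.filter fun l => l x (some i) ⬝ᵥ l y none = 0)
      (fun l hl => Finset.mem_image_of_mem g (Finset.mem_filter.1 hl).1),
    Finset.mul_sum, Finset.mul_sum]
  refine Finset.sum_le_sum fun b hb => ?_
  obtain ⟨l, hl, rfl⟩ := Finset.mem_image.1 hb
  obtain ⟨hlΩ, hlE⟩ := Finset.mem_filter.1 hl
  obtain ⟨A, B, ⟨a₀, ha₀, b₀, hb₀, hne⟩, hAB⟩ := h l hlΩ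
  have hmem : ∀ a r, replaceVectors l x i y a r ∈ T ↔ a ∈ A ∧ r ∈ B := by
    intro a r
    rw [← hAB a r, hT, Finset.mem_filter]
    refine ⟨fun h => h.1, fun h => ⟨h, hE l _ (fun v hx hy => ?_) hlE⟩⟩
    exact (replaceVectors_of_ne l i a r hx hy).symm
  have hfib : ∀ P : (Fin m → F) → (Fin m → F) → Prop,
      ((T.filter fun l' => P (l' x (some i)) (l' y none)).filter fun l' => g l' = g l).card =
      (Finset.univ.filter fun q : (Fin m → F) × (Fin m → F) =>
        (q.1 ∈ A ∧ q.2 ∈ B) ∧ P q.1 q.2).card := by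
    intro P
    refine Finset.card_bij' (fun l' _ => (l' x (some i), l' y none))
      (fun q _ => replaceVectors l x i y q.1 q.2) ?_ ?_ ?_ ?_
    · intro l' hl'
      obtain ⟨hl', hg⟩ := Finset.mem_filter.1 hl'
      obtain ⟨hl', hP⟩ := Finset.mem_filter.1 hl'
      refine Finset.mem_filter.2 ⟨Finset.mem_univ _, ?_, hP⟩
      rwa [replaceVectors_eq_iff.1 hg.symm, hmem] at hl'
    · intro q hq
      obtain ⟨-, hq, hP⟩ := Finset.mem_filter.1 hq
      refine Finset.mem_filter.2 ⟨Finset.mem_filter.2 ⟨(hmem _ _).2 hq, ?_⟩, ?_⟩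
      · rwa [replaceVectors_some, replaceVectors_none]
      · refine (replaceVectors_eq_iff.2 ?_).symm
        rw [replaceVectors_some, replaceVectors_none]
    · intro l' hl'
      exact (replaceVectors_eq_iff.1 (Finset.mem_filter.1 hl').2.symm).symm
    · intro q _
      simp only [replaceVectors_some, replaceVectors_none]
  have h1 := hfib fun a r => a ⬝ᵥ r = 0
  have h2 := hfib fun _ _ => True
  simp only [Finset.filter_true, and_true] at h2
  rw [h1, h2]
  exact card_mul_card_filter_orthogonal_le A B ha₀ hb₀ hne

open scoped Classical in
/-- If the relevant vectors of non-adjacent vertices are free in `Ω`, then the uniform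
distribution on `Ω` is a robust labeling. -/
theorem isRobustLabeling_of_freeAt {n : ℕ} {G : SimpleGraph (Fin n)} {ε : ℝ}
    (hε : (4 * k : ℝ) ≤ ε * Fintype.card F) {Ω : Finset (Fin n → VectorLabel F k m)}
    (hΩ : Ω.Nonempty) (hacc : ∀ l ∈ Ω, ∀ u v, G.Adj u v → VectorLabel.Accepts (l u) (l v))
    (hfree : ∀ x y, ¬ G.Adj x y → ∀ i,
      FreeAt (Ω : Set (Fin n → VectorLabel F k m)) x i y) :
    IsRobustLabeling VectorLabel.Accepts ε G Ω := by
  refine ⟨hΩ, hacc, fun x y hxy E hE => ?_⟩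
  have hq : (0 : ℝ) < Fintype.card F := by exact_mod_cast Fintype.card_pos
  set T := Ω.filter (· ∈ E)
  have h1 : (Ω.filter fun l => l ∈ E ∧ VectorLabel.Accepts (l x) (l y)) ⊆
      Finset.univ.biUnion fun i : Fin k =>
        (Ω.filter fun l => l ∈ E ∧ l x (some i) ⬝ᵥ l y none = 0) ∪
        (Ω.filter fun l => l ∈ E ∧ l y (some i) ⬝ᵥ l x none = 0) := by
    intro l hl
    obtain ⟨hl, hlE, -, i, hi⟩ := Finset.mem_filter.1 hl
    refine Finset.mem_biUnion.2 ⟨i, Finset.mem_univ _, Finset.mem_union.2 ?_⟩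
    exact hi.imp (fun h => Finset.mem_filter.2 ⟨hl, hlE, h⟩)
      (fun h => Finset.mem_filter.2 ⟨hl, hlE, h⟩)
  -- A union bound over k indices and two orders of the pair, each contributing 2/|F|.
  have h2 : Fintype.card F * (Ω.filter fun l => l ∈ E ∧ VectorLabel.Accepts (l x) (l y)).card ≤
      4 * k * T.card := by
    calc _ ≤ Fintype.card F * ∑ i : Fin k,
          ((Ω.filter fun l => l ∈ E ∧ l x (some i) ⬝ᵥ l y none = 0).card +
          (Ω.filter fun l => l ∈ E ∧ l y (some i) ⬝ᵥ l x none = 0).card) := by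
          refine Nat.mul_le_mul_left _ ((Finset.card_le_card h1).trans ?_)
          refine Finset.card_biUnion_le.trans (Finset.sum_le_sum fun i _ => ?_)
          exact Finset.card_union_le _ _
      _ ≤ ∑ i : Fin k, (2 * T.card + 2 * T.card) := by
          rw [Finset.mul_sum]
          refine Finset.sum_le_sum fun i _ => ?_
          rw [mul_add]
          refine add_le_add ((hfree x y hxy i).card_mul_card_filter_le E hE)
            ((hfree y x (fun h => hxy h.symm) i).card_mul_card_filter_le E ?_)
          exact fun l l' h => hE l l' fun v hx hy => h v hy hx
      _ = 4 * k * T.card := by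
          rw [Finset.sum_const, Finset.card_univ, Fintype.card_fin, smul_eq_mul]; ring
  have h3 : (Fintype.card F : ℝ) *
      (Ω.filter fun l => l ∈ E ∧ VectorLabel.Accepts (l x) (l y)).card ≤ 4 * k * T.card := by
    exact_mod_cast h2
  have h4 : (4 * k : ℝ) * T.card ≤ ε * Fintype.card F * T.card := by gcongr
  refine le_of_mul_le_mul_left ?_ hq
  linarith

end Vectors

/-! ### Orthogonal spaces and their dimensions -/

section Orthogonal

variable {F : Type} [Field F]

/-- The subspace of the vectors that are orthogonal to all elements of `S`. -/
def orthogonalVectors {m : ℕ} (S : Set (Fin m → F)) : Submodule F (Fin m → F) where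
  carrier := {x | ∀ s ∈ S, s ⬝ᵥ x = 0}
  add_mem' ha hb s hs := by rw [dotProduct_add, ha s hs, hb s hs, add_zero]
  zero_mem' s _ := dotProduct_zero s
  smul_mem' c x hx s hs := by rw [dotProduct_smul, hx s hs, smul_zero]

theorem mem_orthogonalVectors {m : ℕ} {S : Set (Fin m → F)} {x : Fin m → F} :
    x ∈ orthogonalVectors S ↔ ∀ s ∈ S, s ⬝ᵥ x = 0 := Iff.rfl

theorem finrank_add_finrank_orthogonalVectors {m : ℕ} (W : Submodule F (Fin m → F)) :
    Module.finrank F W + Module.finrank F (orthogonalVectors (W : Set (Fin m → F))) = m := by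
  let B : LinearMap.BilinForm F (Fin m → F) := dotProductBilin F F
  have hrefl : B.IsRefl := fun x y h => by
    change y ⬝ᵥ x = 0
    rw [dotProduct_comm]; exact h
  have hB : B.Nondegenerate := by
    refine ⟨fun x hx => dotProduct_eq_zero x hx, fun x hx => dotProduct_eq_zero x fun w => ?_⟩
    rw [dotProduct_comm]; exact hx w
  have h := LinearMap.BilinForm.finrank_orthogonal hB W
  have he : orthogonalVectors (W : Set (Fin m → F)) = B.orthogonal W := by
    ext x
    rfl
  have hle := Submodule.finrank_le W
  rw [Module.finrank_fin_fun] at h hle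
  rw [he, h]
  omega

theorem orthogonalVectors_span {m : ℕ} (S : Set (Fin m → F)) :
    orthogonalVectors (Submodule.span F S : Set (Fin m → F)) = orthogonalVectors S := by
  ext x
  refine ⟨fun h s hs => h s (Submodule.subset_span hs), fun h s hs => ?_⟩
  induction hs using Submodule.span_induction with
  | mem s hs => exact h s hs
  | zero => exact zero_dotProduct x
  | add s t _ _ hs ht => rw [add_dotProduct, hs, ht, add_zero]
  | smul c s _ hs => rw [smul_dotProduct, hs, smul_zero]

theorem le_card_add_finrank_orthogonalVectors {m : ℕ} (S : Finset (Fin m → F)) :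
    m ≤ S.card + Module.finrank F (orthogonalVectors (S : Set (Fin m → F))) := by
  have h1 := finrank_add_finrank_orthogonalVectors (Submodule.span F (S : Set (Fin m → F)))
  have h2 := finrank_span_finset_le_card (R := F) S
  rw [orthogonalVectors_span] at h1
  unfold Set.finrank at h2
  omega

/-- Two subspaces of small codimension are not orthogonal to each other. -/
theorem exists_dotProduct_ne_zero {m : ℕ} (S T : Finset (Fin m → F)) (h : S.card + T.card < m) :
    ∃ a ∈ orthogonalVectors (S : Set (Fin m → F)), ∃ b ∈ orthogonalVectors (T : Set (Fin m → F)),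
      a ⬝ᵥ b ≠ 0 := by
  -- Otherwise T^⊥, of dimension at least m - |T| > |S|, would lie in S^⊥⊥, of dimension at most
  -- |S|.
  by_contra! hc
  have h1 := le_card_add_finrank_orthogonalVectors S
  have h2 := le_card_add_finrank_orthogonalVectors T
  have h3 := finrank_add_finrank_orthogonalVectors (orthogonalVectors (S : Set (Fin m → F)))
  have h4 : orthogonalVectors (T : Set (Fin m → F)) ≤
      orthogonalVectors (orthogonalVectors (S : Set (Fin m → F)) : Set (Fin m → F)) :=
    fun b hb a ha => hc a ha b hb
  have h5 := Submodule.finrank_mono h4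
  omega

end Orthogonal

/-! ### Robust labelings in bounded degree -/

open scoped Classical in
/-- In bounded degree, the uniform distribution on all labelings in which the vectors of adjacent
vertices are orthogonal is robust. -/
theorem exists_isRobustLabeling_of_degree_le {F : Type} [Field F] [Fintype F] {n k m d : ℕ}
    {ε : ℝ} (hε : (4 * k : ℝ) ≤ ε * Fintype.card F) (hk : 0 < k) {G : SimpleGraph (Fin n)}
    (hd : ∀ v, G.degree v ≤ d) (hm : (k + 1) * d < m) :
    ∃ Ω : Finset (Fin n → VectorLabel F k m), IsRobustLabeling VectorLabel.Accepts ε G Ω := by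
  let Ω : Finset (Fin n → VectorLabel F k m) :=
    Finset.univ.filter fun l => ∀ u v, G.Adj u v → ∀ i, l u (some i) ⬝ᵥ l v none = 0
  have hΩ : ∀ l, l ∈ Ω ↔ ∀ u v, G.Adj u v → ∀ i, l u (some i) ⬝ᵥ l v none = 0 := fun l => by
    simp [Ω]
  refine ⟨Ω, isRobustLabeling_of_freeAt hε ⟨0, (hΩ 0).2 ?_⟩ ?_ ?_⟩
  · intro u v _ i
    exact zero_dotProduct _
  · intro l hl u v huv
    exact ⟨by omega, ⟨0, hk⟩, Or.inl ((hΩ l).1 hl u v huv _)⟩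
  · intro x y hxy i l hl
    have hl := (hΩ l).1 (by simpa using hl)
    -- `S` and `T` hold the conditions on the two replaced vectors. As xy is not an edge, neither of
    -- these vectors occurs in a condition on the other.
    let S : Finset (Fin m → F) := (G.neighborFinset x).image fun v => l v none
    let T : Finset (Fin m → F) := ((G.neighborFinset y) ×ˢ (Finset.univ : Finset (Fin k))).image
      fun q => l q.1 (some q.2)
    have hS : S.card ≤ d := Finset.card_image_le.trans (hd x)
    have hT : T.card ≤ d * k := by
      refine Finset.card_image_le.trans ?_
      rw [Finset.card_product, Finset.card_univ, Fintype.card_fin]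
      exact Nat.mul_le_mul_right k (hd y)
    refine ⟨orthogonalVectors (S : Set (Fin m → F)), orthogonalVectors (T : Set (Fin m → F)),
      exists_dotProduct_ne_zero S T (by nlinarith), fun a b => ?_⟩
    rw [Finset.mem_coe, hΩ, mem_orthogonalVectors, mem_orthogonalVectors]
    constructor
    · intro h
      constructor
      · intro s hs
        obtain ⟨v, hv, rfl⟩ := Finset.mem_image.1 hs
        have hv : G.Adj x v := by simpa using hv
        have hvy : v ≠ y := fun e => hxy (e ▸ hv)
        rw [dotProduct_comm]
        simpa [replaceVectors, hvy] using h x v hv i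
      · intro s hs
        obtain ⟨⟨u, j⟩, hu, rfl⟩ := Finset.mem_image.1 hs
        have hu : G.Adj y u := by simpa using hu
        have hux : u ≠ x := fun e => hxy (e ▸ hu.symm)
        simpa [replaceVectors, hux] using h u y hu.symm j
    · rintro ⟨ha, hb⟩ u v huv j
      simp only [replaceVectors]
      split_ifs with h1 h2 h2
      · obtain ⟨rfl, rfl⟩ := h1
        exact absurd (h2 ▸ huv) hxy
      · obtain ⟨rfl, rfl⟩ := h1
        rw [dotProduct_comm]
        exact ha _ (Finset.mem_image.2 ⟨v, by simpa using huv, rfl⟩)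
      · subst h2
        exact hb _ (Finset.mem_image.2 ⟨(u, j), by simpa using huv.symm, rfl⟩)
      · exact hl u v huv j

/-! ### Parents in forests -/

/-- If v lies on the path from u to r, acyclicity makes it the second vertex. If not, prepending v
gives a path from v to r, which is the unique one, and its second vertex is u. -/
theorem SimpleGraph.IsAcyclic.eq_snd_or_eq_snd {V : Type*} {G : SimpleGraph V} (hG : G.IsAcyclic)
    {u v r : V} {p : G.Walk u r} {q : G.Walk v r} (hp : p.IsPath) (hq : q.IsPath)
    (h : G.Adj u v) : (u ≠ r ∧ v = p.snd) ∨ (v ≠ r ∧ u = q.snd) := by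
  by_cases hv : v ∈ p.support
  · have hsnd := hG.eq_snd_of_adj_start hp h hv
    refine Or.inl ⟨?_, hsnd⟩
    rintro rfl
    rw [(Walk.isPath_iff_nil.1 hp).eq_nil] at hsnd
    exact h.ne (by simpa using hsnd.symm)
  · have hc : (Walk.cons h.symm p).IsPath := hp.cons hv
    have hqc : q = Walk.cons h.symm p :=
      Subtype.mk.inj ((hG.subsingleton_path v r).elim ⟨q, hq⟩ ⟨_, hc⟩)
    refine Or.inr ⟨?_, by simp [hqc]⟩
    rintro rfl
    exact hv p.end_mem_support

/-- In a forest one can choose a parent of every vertex, except for the roots of the trees, such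
that the edges are the pairs of a vertex and its parent. -/
theorem SimpleGraph.IsAcyclic.exists_parent {V : Type*} {G : SimpleGraph V} (hG : G.IsAcyclic) :
    ∃ p : V → Option V, ∀ u v, G.Adj u v ↔ p u = some v ∨ p v = some u := by
  classical
  let root : V → V := fun v => (G.connectedComponentMk v).out
  have hroot : ∀ v, G.Reachable v (root v) := fun v =>
    (ConnectedComponent.exact (Quot.out_eq (G.connectedComponentMk v))).symm
  have hpath : ∀ v, ∃ w, ∃ p : G.Walk v (root v), p.IsPath ∧ w = p.snd := fun v => by
    obtain ⟨p, hp⟩ := (hroot v).exists_isPath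
    exact ⟨_, p, hp, rfl⟩
  choose s hs using hpath
  refine ⟨fun u => if u = root u then none else some (s u), fun u v => ⟨fun h => ?_, ?_⟩⟩
  · have hr : root u = root v := by
      simp only [root, ConnectedComponent.sound h.reachable]
    obtain ⟨q, hq, hsv⟩ := hs v
    have hu := hs u
    rw [hr] at hu
    obtain ⟨p, hp, hsu⟩ := hu
    refine (hG.eq_snd_or_eq_snd hp hq h).imp (fun hh => ?_) (fun hh => ?_) <;> beta_reduce
    · rw [if_neg (hr ▸ hh.1), hsu, ← hh.2]
    · rw [if_neg hh.1, hsv, ← hh.2]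
  · have key : ∀ u v, (if u = root u then none else some (s u)) = some v → G.Adj u v := by
      intro u v h
      split_ifs at h with hu
      obtain rfl := Option.some.inj h
      obtain ⟨p, -, hsu⟩ := hs u
      rw [hsu]
      exact p.adj_snd (fun hn => hu hn.eq)
    rintro (h | h)
    · exact key u v h
    · exact (key v u h).symm

theorem SimpleGraph.exists_parents_of_arboricity_le {V : Type*} {G : SimpleGraph V} {k : ℕ}
    (h : G.arboricity ≤ k) :
    ∃ p : Fin k → V → Option V, ∀ u v, G.Adj u v ↔ ∃ i, p i u = some v ∨ p i v = some u := by
  have h1 : G.arboricity < (k + 1 : ℕ) := lt_of_le_of_lt h (by exact_mod_cast Nat.lt_succ_self k)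
  unfold SimpleGraph.arboricity at h1
  obtain ⟨j, hj⟩ := iInf_lt_iff.1 h1
  obtain ⟨⟨T, hac, -, hun⟩, hj⟩ := iInf_lt_iff.1 hj
  have hjk : j ≤ k := Nat.lt_succ_iff.1 (by exact_mod_cast hj)
  choose p hp using fun i => (hac i).exists_parent
  -- Indices beyond the number j ≤ k of forests get no parents.
  refine ⟨fun i u => if hi : (i : ℕ) < j then p ⟨i, hi⟩ u else none, fun u v => ?_⟩
  have h2 : G.Adj u v ↔ ∃ i, (T i).Adj u v := by
    rw [← SimpleGraph.mem_edgeSet, ← hun, Set.mem_iUnion]; rfl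
  rw [h2]
  constructor
  · rintro ⟨i, hi⟩
    refine ⟨Fin.castLE hjk i, ?_⟩
    have : ((Fin.castLE hjk i : Fin k) : ℕ) < j := i.2
    simp only [this, dite_true]
    exact (hp i u v).1 hi
  · rintro ⟨i, hi⟩
    by_cases hij : (i : ℕ) < j
    · simp only [hij, dite_true] at hi
      exact ⟨⟨i, hij⟩, (hp _ u v).2 hi⟩
    · simp [hij] at hi

/-! ### Robust labelings from graphs of matrices -/

open scoped Matrix

/-- The graph of a square matrix, as a subspace. -/
def matrixGraph {F : Type} [Field F] {t : ℕ} (M : Matrix (Fin t) (Fin t) F) :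
    Submodule F (Fin (t + t) → F) where
  carrier := {a | ∃ w, a = Fin.append w (M *ᵥ w)}
  add_mem' := by
    rintro _ _ ⟨w, rfl⟩ ⟨w', rfl⟩
    refine ⟨w + w', ?_⟩
    funext i
    refine Fin.addCases (fun j => ?_) (fun j => ?_) i <;> simp [-Fin.natAdd_eq_addNat, Matrix.mulVec_add]
  zero_mem' := by
    refine ⟨0, ?_⟩
    funext i
    refine Fin.addCases (fun j => ?_) (fun j => ?_) i <;> simp [-Fin.natAdd_eq_addNat]
  smul_mem' := by
    rintro c _ ⟨w, rfl⟩
    refine ⟨c • w, ?_⟩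
    funext i
    refine Fin.addCases (fun j => ?_) (fun j => ?_) i <;> simp [-Fin.natAdd_eq_addNat, Matrix.mulVec_smul]

theorem append_dotProduct_append {F : Type} [Field F] {s t : ℕ} (a c : Fin s → F)
    (b d : Fin t → F) : Fin.append a b ⬝ᵥ Fin.append c d = a ⬝ᵥ c + b ⬝ᵥ d := by
  simp [dotProduct, Fin.sum_univ_add]

/-- The graph of a matrix is not orthogonal to the orthogonal space of the graph of another. -/
theorem exists_matrixGraph_dotProduct_ne_zero {F : Type} [Field F] {t : ℕ}
    {M N : Matrix (Fin t) (Fin t) F} (h : M ≠ N) :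
    ∃ a ∈ matrixGraph M, ∃ b ∈ orthogonalVectors (matrixGraph N : Set (Fin (t + t) → F)),
      a ⬝ᵥ b ≠ 0 := by
  obtain ⟨w, hw⟩ : ∃ w, M *ᵥ w ≠ N *ᵥ w := by
    by_contra! hc
    exact h (Matrix.ext_of_mulVec_single fun i => hc _)
  obtain ⟨z, hz⟩ : ∃ z, (M *ᵥ w - N *ᵥ w) ⬝ᵥ z ≠ 0 := by
    by_contra! hc
    exact hw (sub_eq_zero.1 (dotProduct_eq_zero _ hc))
  -- The vector (-zN, z) is orthogonal to the graph of `N` and detects the difference of the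
  -- matrices at w.
  have key : ∀ (L : Matrix (Fin t) (Fin t) F) (v : Fin t → F),
      Fin.append v (L *ᵥ v) ⬝ᵥ Fin.append (-(z ᵥ* N)) z = (L *ᵥ v - N *ᵥ v) ⬝ᵥ z := by
    intro L v
    rw [append_dotProduct_append, dotProduct_neg, dotProduct_comm v, ← Matrix.dotProduct_mulVec,
      sub_dotProduct, dotProduct_comm z]
    ring
  refine ⟨_, ⟨w, rfl⟩, Fin.append (-(z ᵥ* N)) z, ?_, ?_⟩
  · rintro _ ⟨v, rfl⟩
    rw [key, sub_self, zero_dotProduct]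
  · rwa [key]

open scoped Classical in
/-- If the edges are given by `k` parent functions, then independent vectors in subspaces
assigned to the parents form a robust labeling. -/
theorem exists_isRobustLabeling_of_parents {F : Type} [Field F] [Fintype F] {n k t : ℕ}
    {ε : ℝ} (hε : (4 * k : ℝ) ≤ ε * Fintype.card F) {G : SimpleGraph (Fin n)}
    (p : Fin k → Fin n → Option (Fin n))
    (hp : ∀ u v, G.Adj u v ↔ ∃ i, p i u = some v ∨ p i v = some u)
    (ht : 0 < t) (hn : n + 1 ≤ 2 ^ (t * t)) :
    ∃ Ω : Finset (Fin n → VectorLabel F k (t + t)),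
      IsRobustLabeling VectorLabel.Accepts ε G Ω := by
  -- A missing parent also needs a matrix of its own, hence n + 1 of them.
  have hcard : Fintype.card (Option (Fin n)) ≤ Fintype.card (Matrix (Fin t) (Fin t) F) := by
    change _ ≤ Fintype.card (Fin t → Fin t → F)
    rw [Fintype.card_option, Fintype.card_fin, Fintype.card_fun, Fintype.card_fun,
      Fintype.card_fin, ← pow_mul]
    exact hn.trans (Nat.pow_le_pow_left Fintype.one_lt_card _)
  obtain ⟨M⟩ := Function.Embedding.nonempty_of_card_le hcard
  let A : Option (Fin n) → Submodule F (Fin (t + t) → F) := fun v => matrixGraph (M v)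
  let R : Fin n → Submodule F (Fin (t + t) → F) := fun v =>
    orthogonalVectors (A (some v) : Set (Fin (t + t) → F))
  let Ω : Finset (Fin n → VectorLabel F k (t + t)) :=
    Finset.univ.filter fun l => ∀ u, (∀ i, l u (some i) ∈ A (p i u)) ∧ l u none ∈ R u
  have hΩ : ∀ l, l ∈ Ω ↔ ∀ u, (∀ i, l u (some i) ∈ A (p i u)) ∧ l u none ∈ R u := fun l => by
    simp [Ω]
  refine ⟨Ω, isRobustLabeling_of_freeAt hε ⟨0, (hΩ 0).2 ?_⟩ ?_ ?_⟩
  · exact fun u => ⟨fun i => Submodule.zero_mem _, Submodule.zero_mem _⟩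
  · intro l hl u v huv
    have hl := (hΩ l).1 hl
    obtain ⟨i, hi⟩ := (hp u v).1 huv
    refine ⟨by omega, i, hi.imp (fun h => ?_) (fun h => ?_)⟩
    · exact (hl v).2 _ (h ▸ (hl u).1 i)
    · exact (hl u).2 _ (h ▸ (hl v).1 i)
  · intro x y hxy i l hl
    have hl := (hΩ l).1 (by simpa using hl)
    have hne : p i x ≠ some y := fun h => hxy ((hp x y).2 ⟨i, Or.inl h⟩)
    refine ⟨A (p i x), R y, exists_matrixGraph_dotProduct_ne_zero (M.injective.ne hne),
      fun a b => ?_⟩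
    rw [Finset.mem_coe, hΩ]
    constructor
    · intro h
      have h1 := (h x).1 i
      have h2 := (h y).2
      rw [replaceVectors_some] at h1
      rw [replaceVectors_none] at h2
      exact ⟨h1, h2⟩
    · rintro ⟨ha, hb⟩ u
      refine ⟨fun j => ?_, ?_⟩
      · simp only [replaceVectors]
        split_ifs with h
        · rw [h.1, h.2]; exact ha
        · exact (hl u).1 j
      · simp only [replaceVectors]
        split_ifs with h
        · rw [h]; exact hb
        · exact (hl u).2

/-! ### Choice of the dimension and conclusion -/

/-- A dimension of the vectors that suffices for `n` vertices and maximum degree `d`. -/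
noncomputable def vectorDimension (k d n : ℕ) : ℕ :=
  -- Here the size bound is 0, so labels must be empty; the graph has no edges, and
  -- `VectorLabel.Accepts` rejects everything in dimension 0.
  if d = 0 ∨ n ≤ 1 then 0
  else if (d : ℝ) ≤ Real.sqrt (Real.logb 2 n) then (k + 1) * d + 1
  else (⌈Real.sqrt (Real.logb 2 n)⌉₊ + 1) + (⌈Real.sqrt (Real.logb 2 n)⌉₊ + 1)

/-- For d ≥ 1, (k+1)d + 1 ≤ (k+2)d. For s = √(log₂ n) ≥ 1, 2(⌈s⌉ + 1) ≤ 2s + 4 ≤ 6s ≤ (k+5)s, as k ≥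
1. -/
theorem vectorDimension_le {k : ℕ} (hk : 0 < k) (d n : ℕ) :
    (vectorDimension k d n : ℝ) ≤ (k + 5) * min (d : ℝ) (Real.sqrt (Real.logb 2 n)) := by
  unfold vectorDimension
  split_ifs with h1 h2
  · rw [Nat.cast_zero]; positivity
  · rw [min_eq_left h2]
    have hd : (1 : ℝ) ≤ d := by exact_mod_cast (by omega : 1 ≤ d)
    push_cast
    linarith
  · rw [min_eq_right (not_le.1 h2).le]
    have hs : (1 : ℝ) ≤ Real.sqrt (Real.logb 2 n) := by
      rw [Real.one_le_sqrt, Real.le_logb_iff_rpow_le one_lt_two (by norm_cast; omega),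
        Real.rpow_one]
      exact_mod_cast (by omega : 2 ≤ n)
    have hc := (Nat.ceil_lt_add_one (Real.sqrt_nonneg (Real.logb 2 n))).le
    have hk' : (1 : ℝ) ≤ k := by exact_mod_cast hk
    push_cast
    nlinarith

theorem add_one_le_two_pow_ceil_sqrt_logb {n : ℕ} (hn : 1 ≤ n) :
    n + 1 ≤ 2 ^ ((⌈Real.sqrt (Real.logb 2 n)⌉₊ + 1) * (⌈Real.sqrt (Real.logb 2 n)⌉₊ + 1)) := by
  set c := ⌈Real.sqrt (Real.logb 2 n)⌉₊
  have h0 : 0 ≤ Real.logb 2 n := Real.logb_nonneg one_lt_two (by exact_mod_cast hn)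
  have h1 : Real.logb 2 n ≤ (c * c : ℕ) := by
    rw [← Real.mul_self_sqrt h0]
    push_cast
    have := Nat.le_ceil (Real.sqrt (Real.logb 2 n))
    gcongr
  have h2 : n ≤ 2 ^ (c * c) := by
    rw [Real.logb_le_iff_le_rpow one_lt_two (by exact_mod_cast hn), Real.rpow_natCast] at h1
    exact_mod_cast h1
  calc n + 1 ≤ 2 ^ (c * c) + 2 ^ (c * c) := add_le_add h2 Nat.one_le_two_pow
    _ = 2 ^ (c * c + 1) := by ring
    _ ≤ 2 ^ ((c + 1) * (c + 1)) := Nat.pow_le_pow_right two_pos (by nlinarith)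

open scoped Classical in
theorem isRobustLabeling_singleton {n : ℕ} {Λ : Type} {acc : Λ → Λ → Prop} {ε : ℝ} (h0 : 0 ≤ ε)
    {G : SimpleGraph (Fin n)} (hedge : ∀ u v, ¬ G.Adj u v) (hacc : ∀ s t, ¬ acc s t)
    (l₀ : Fin n → Λ) : IsRobustLabeling acc ε G {l₀} := by
  refine ⟨⟨l₀, Finset.mem_singleton_self l₀⟩, fun l _ u v h => absurd h (hedge u v),
      fun x y _ E _ => ?_⟩
  rw [Finset.filter_false_of_mem fun l _ h => hacc _ _ h.2, Finset.card_empty, Nat.cast_zero]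
  exact mul_nonneg h0 (Nat.cast_nonneg _)

open scoped Classical in
theorem exists_isRobustLabeling_of_mem {F : Type} [Field F] [Fintype F] {k d n : ℕ} {ε : ℝ}
    (hk : 0 < k) (h0 : 0 ≤ ε) (hε : (4 * k : ℝ) ≤ ε * Fintype.card F) {G : SimpleGraph (Fin n)}
    (hG : G ∈ boundedArboricityDegree k d n) :
    ∃ Ω : Finset (Fin n → VectorLabel F k (vectorDimension k d n)),
      IsRobustLabeling VectorLabel.Accepts ε G Ω := by
  obtain ⟨harb, hdeg⟩ := hG
  have hd : ∀ v, G.degree v ≤ d := fun v => by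
    refine le_trans ?_ ((G.degree_le_maxDegree v).trans hdeg)
    exact le_of_eq (by congr)
  by_cases h1 : d = 0 ∨ n ≤ 1
  · have hedge : ∀ u v, ¬ G.Adj u v := by
      intro u v huv
      rcases h1 with h1 | h1
      · have := (G.degree_pos_iff_exists_adj u).2 ⟨v, huv⟩
        have := hd u
        omega
      · exact huv.ne (Fin.ext (by omega))
    have hm : vectorDimension k d n = 0 := if_pos h1
    exact ⟨{0}, isRobustLabeling_singleton h0 hedge (fun s t h => h.1.ne' hm) 0⟩
  by_cases h2 : (d : ℝ) ≤ Real.sqrt (Real.logb 2 n)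
  · have hm : vectorDimension k d n = (k + 1) * d + 1 := (if_neg h1).trans (if_pos h2)
    exact exists_isRobustLabeling_of_degree_le hε hk hd (hm ▸ Nat.lt_succ_self _)
  · have hm : vectorDimension k d n = _ := (if_neg h1).trans (if_neg h2)
    rw [hm]
    obtain ⟨p, hp⟩ := SimpleGraph.exists_parents_of_arboricity_le harb
    exact exists_isRobustLabeling_of_parents hε p hp (Nat.succ_pos _)
      (add_one_le_two_pow_ceil_sqrt_logb (by omega))

theorem boundedArboricityDegree_mono {k k' : ℕ} (h : k ≤ k') (d n : ℕ) :
    boundedArboricityDegree k d n ⊆ boundedArboricityDegree k' d n :=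
  fun _ hG => ⟨hG.1.trans (by exact_mod_cast h), hG.2⟩

theorem mainTheorem7 (k : ℕ) (ε : ℝ) (hε : 0 < ε) (hε1 : ε < 1) :
    ∃ C : ℝ, 0 < C ∧ ∀ d : ℕ, ∃ S : AdjacencySketch,
      S.IsSketchFor (boundedArboricityDegree k d) ε ∧
      S.IsResilient (boundedArboricityDegree k d) ε ∧
      ∀ n : ℕ, (S.size n : ℝ) ≤ C * min (d : ℝ) (Real.sqrt (Real.logb 2 n)) := by
  -- Passing from k to k + 1 provides at least one vector a i even when k = 0.
  obtain ⟨p, hpN, hp⟩ := Nat.exists_infinite_primes ⌈(4 * (k + 1 : ℕ) : ℝ) / ε⌉₊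
  have : Fact p.Prime := ⟨hp⟩
  have hpε : (4 * (k + 1 : ℕ) : ℝ) ≤ ε * Fintype.card (ZMod p) := by
    rw [ZMod.card, mul_comm ε, ← div_le_iff₀ hε]
    exact Nat.ceil_le.1 hpN
  have hp0 := hp.pos
  have hpR : (0 : ℝ) < p := by exact_mod_cast hp0
  refine ⟨p * (k + 2) * ((k + 1 : ℕ) + 5), by positivity, fun d => ?_⟩
  obtain ⟨S, h1, h2, h3⟩ := exists_sketch_of_robustLabeling
    (Λ := fun m => VectorLabel (ZMod p) (k + 1) m) (c := fun m => p * (k + 2) * m)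
    (fun m m' h => Nat.eq_of_mul_eq_mul_left (by positivity) h)
    (fun m => by
      rw [Fintype.card_fun, Fintype.card_fun, ZMod.card, Fintype.card_option, Fintype.card_fin,
        Fintype.card_fin, ← pow_mul]
      -- The crude p ≤ 2^p allots p bits to a field element; p depends on k and ε only.
      calc p ^ (m * (k + 1 + 1)) ≤ (2 ^ p) ^ (m * (k + 1 + 1)) :=
            Nat.pow_le_pow_left Nat.lt_two_pow_self.le _
        _ = 2 ^ (p * (k + 2) * m) := by rw [← pow_mul]; ring_nf)
    (fun m => VectorLabel.Accepts) (boundedArboricityDegree k d) hε.le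
    (vectorDimension (k + 1) d)
    (fun n G hG => exists_isRobustLabeling_of_mem (Nat.succ_pos k) hε.le hpε
      (boundedArboricityDegree_mono (Nat.le_succ k) d n hG))
  refine ⟨S, h1, h2, fun n => ?_⟩
  rw [h3]
  push_cast
  have h4 := vectorDimension_le (Nat.succ_pos k) d n
  push_cast at h4
  calc (p : ℝ) * (k + 2) * vectorDimension (k + 1) d n
      ≤ p * (k + 2) * ((k + 1 + 5) * min (d : ℝ) (Real.sqrt (Real.logb 2 n))) := by gcongr
    _ = _ := by ring
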